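/- Let $k\ge 1$ and let $\Theta=(\theta_{ij})$ be a random symmetric $k\times k$ real matrix with a sparsity pattern $z=(z_{ij})_{i<j}\in\{0,1\}^{k(k-1)/2}$. Given $Z=z$, the diagonal entries $\theta_{ii}\sim\pi_{ii}$ are mutually independent (with arbitrary probability laws $\pi_{ii}$ on $\mathbb R$) and independent of the off-diagonal entries; $\theta_{ij}=0$ when $z_{ij}=0$, and the entries $\theta_{ij}$ with $z_{ij}=1$, $i<j$, are distributed as the corresponding coordinates of a slab law $p$ on $\mathbb R^{k(k-1)/2}$. Suppose that under $p$ the entries are independent with $\theta_{ij}\sim N(0,\sigma_{ij}^2)$ for $i<j$ or, more generally, that for some probability law $\Pi$ on families of variances $$p(\{\theta_{ij}\}_{i<j})=\int\prod_{i<j}N(\theta_{ij};0,\sigma_{ij}^2)\,d\Pi(\{\sigma_{ij}^2\}_{i<j}),$$ where $N(\cdot\,;0,0)$ denotes the Dirac mass at $0$. Let $\lambda_{\min}(\Theta)$ be the smallest eigenvalue of $\Theta$. An expectation is said to exist if the positive or the negative part of the random variable has finite expectation; it is then a number in $[-\infty,\infty]$. 1. For fixed patterns $z,z'$ with $z_{ij}\le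 z'_{ij}$ for all $i<j$, $$\mathbb E[\lambda_{\min}(\Theta)\mid Z=z]\ \ge\ \mathbb E[\lambda_{\min}(\Theta)\mid Z=z'],$$ provided that both expectations exist. 2. Let instead $Z$ be random with independent entries $Z_{ij}\sim\mathrm{Bern}(\eta_{ij})$, $\eta_{ij}\in[0,1]$. Then $\mathbb E[\lambda_{\min}(\Theta)]$ is decreasing (that is, non-increasing) in each $\eta_{ij}$: if $\eta_{ij}\le\eta'_{ij}$ for all $i<j$, then the expectation under $\eta'$ is at most the one under $\eta$, provided that both exist. 3. All these expectations (for every $z$ and every $\eta$) exist if $\theta_{ii}\ge 0$ almost surely for all $i$ and the slabs are independent Gaussians or, more generally, have $\mathbb E_p|\theta_{ij}|<\infty$ for all $i<j$. They also exist, for every slab law as above, if some $\theta_{ii}$ has $\mathbb E|\theta_{ii}|<\infty$. They are finite if $\mathbb E|\theta_{ii}|<\infty$ for all $i$ and the slabs are independent Gaussians or have $\mathbb E_p|\theta_{ij}|<\infty$ for all $i<j$. -/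

import Mathlib

open MeasureTheory ProbabilityTheory
open scoped NNReal ENNReal

/-- The positions `(i, j)`, `i < j`, of the off-diagonal entries of a symmetric `k × k` matrix. -/
abbrev OffDiag (k : ℕ) : Type := {e : Fin k × Fin k // e.1 < e.2}

/-- A sparsity pattern: `z (i, j)` tells whether the entry at `i < j` is active (`z_ij = 1`).
The order on patterns is the entrywise one, with `false ≤ true`. -/
abbrev Pattern (k : ℕ) : Type := OffDiag k → Bool

/-- The free entries of a symmetric `k × k` matrix: the diagonal, and the entries at `i < j`. -/
abbrev Entries (k : ℕ) : Type := (Fin k → ℝ) × (OffDiag k → ℝ)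

/-- The symmetric matrix with the given free entries. -/
def symMatrix {k : ℕ} (x : Entries k) : Matrix (Fin k) (Fin k) ℝ :=
  Matrix.of fun i j =>
    if h : i < j then x.2 ⟨(i, j), h⟩ else if h : j < i then x.2 ⟨(j, i), h⟩ else x.1 i

/-- The smallest eigenvalue of a real symmetric matrix. -/
noncomputable def lambdaMin {k : ℕ} (A : Matrix (Fin k) (Fin k) ℝ) : ℝ :=
  sInf (spectrum ℝ A)

/-- The law of independent centred Gaussians with variances `v e` (possibly degenerate). -/
noncomputable def gaussianSlab {k : ℕ} (v : OffDiag k → ℝ≥0) : Measure (OffDiag k → ℝ) :=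
  Measure.pi fun e => gaussianReal 0 (v e)

/-- The slab entries are independent, and each one is a centred Gaussian. -/
def IsGaussianProduct {k : ℕ} (ν : Measure (OffDiag k → ℝ)) : Prop :=
  ∃ v : OffDiag k → ℝ≥0, ν = gaussianSlab v

/-- The joint law of the slab entries is a scale mixture of centred Gaussians:
`ν = ∫ ∏ N(0, v_ij) dM(v)` for a probability law `M` of the family of variances. -/
def IsGaussianScaleMixture {k : ℕ} (ν : Measure (OffDiag k → ℝ)) : Prop :=
  ∃ M : Measure (OffDiag k → ℝ≥0), IsProbabilityMeasure M ∧ ν = M.bind gaussianSlab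

/-- The off-diagonal entries under the pattern `z`: inactive entries are replaced by `0`. -/
def mask {k : ℕ} (z : Pattern k) (t : OffDiag k → ℝ) : OffDiag k → ℝ :=
  fun e => if z e then t e else 0

/-- The law of (the free entries of) `Θ` given `Z = z`, for diagonal laws `D i` and joint slab
law `ν`: the diagonal entries are independent of each other and of the off-diagonal ones, inactive
entries follow the Dirac mass at `0` and the active ones their slab law. -/
noncomputable def priorGiven {k : ℕ} (D : Fin k → Measure ℝ) (ν : Measure (OffDiag k → ℝ))
    (z : Pattern k) : Measure (Entries k) :=
  (Measure.pi D).prod (ν.map (mask z))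

/-- The law of a random pattern with independent `Z_ij ~ Bern(η_ij)`. -/
noncomputable def patternLaw {k : ℕ} (η : OffDiag k → unitInterval) : Measure (Pattern k) :=
  Measure.pi fun e => bernoulliMeasure true false (η e)

/-- The marginal law of (the free entries of) `Θ` when `Z_ij ~ Bern(η_ij)` independently. -/
noncomputable def prior {k : ℕ} (D : Fin k → Measure ℝ) (ν : Measure (OffDiag k → ℝ))
    (η : OffDiag k → unitInterval) : Measure (Entries k) :=
  (patternLaw η).bind (priorGiven D ν)

/-- `λ_min(Θ)` as a random variable on the space of free entries. -/
noncomputable def lambdaMinΘ {k : ℕ} (x : Entries k) : ℝ := lambdaMin (symMatrix x)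

/-- The expectation of `f` is well defined in `[-∞, ∞]`: its positive part or its negative part
has a finite integral. -/
def HasExpectation {Ω : Type*} [MeasurableSpace Ω] (μ : Measure Ω) (f : Ω → ℝ) : Prop :=
  ∫⁻ x, ENNReal.ofReal (f x) ∂μ ≠ ∞ ∨ ∫⁻ x, ENNReal.ofReal (-f x) ∂μ ≠ ∞

/-- The expectation in `[-∞, ∞]`, meaningful when `HasExpectation μ f`. -/
noncomputable def expectation {Ω : Type*} [MeasurableSpace Ω] (μ : Measure Ω) (f : Ω → ℝ) :
    EReal :=
  ((∫⁻ x, ENNReal.ofReal (f x) ∂μ : ℝ≥0∞) : EReal) -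
    ((∫⁻ x, ENNReal.ofReal (-f x) ∂μ : ℝ≥0∞) : EReal)

/-- The mixture in `IsGaussianScaleMixture` is a mixture over a measurable family. -/
theorem measurable_gaussianSlab {k : ℕ} :
    Measurable (gaussianSlab : (OffDiag k → ℝ≥0) → Measure (OffDiag k → ℝ)) := by
  have inst : ∀ v : OffDiag k → ℝ≥0, IsProbabilityMeasure (gaussianSlab v) := fun v => by
    unfold gaussianSlab; infer_instance
  refine Measurable.measure_of_isPiSystem_of_isProbabilityMeasure
    generateFrom_pi.symm isPiSystem_pi ?_
  rintro _ ⟨s, hs, rfl⟩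
  simp only [gaussianSlab, Measure.pi_pi]
  refine Finset.measurable_prod _ fun e _ => ?_
  have h1 : Measurable fun v : OffDiag k → ℝ≥0 => gaussianReal 0 (v e) :=
    measurable_gaussianReal.comp (measurable_const.prodMk (measurable_pi_apply e))
  have h2 : MeasurableSet (s e) := hs e (Set.mem_univ e)
  exact (Measure.measurable_coe h2).comp h1

/-- The mixture in `prior` is a mixture over a measurable family. -/
theorem measurable_priorGiven {k : ℕ} (D : Fin k → Measure ℝ) (ν : Measure (OffDiag k → ℝ)) :
    Measurable (priorGiven D ν) :=
  measurable_of_countable _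

/-- Independent centred Gaussians are a scale mixture (with constant variances). -/
theorem IsGaussianProduct.isGaussianScaleMixture {k : ℕ} {ν : Measure (OffDiag k → ℝ)}
    (h : IsGaussianProduct ν) : IsGaussianScaleMixture ν := by
  obtain ⟨v, rfl⟩ := h
  exact ⟨Measure.dirac v, inferInstance, (Measure.dirac_bind measurable_gaussianSlab v).symm⟩

theorem isHermitian_symMatrix {k : ℕ} (x : Entries k) : (symMatrix x).IsHermitian := by
  ext i j
  rcases lt_trichotomy i j with h | rfl | h
  · simp [symMatrix, h, h.asymm]
  · simp [symMatrix]
  · simp [symMatrix, h, h.asymm]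

/-- For a symmetric matrix of positive size, `lambdaMin` is indeed its smallest eigenvalue. -/
theorem isLeast_lambdaMin {k : ℕ} (hk : 1 ≤ k) {A : Matrix (Fin k) (Fin k) ℝ}
    (hA : A.IsHermitian) : IsLeast (spectrum ℝ A) (lambdaMin A) := by
  have hne : (spectrum ℝ A).Nonempty := ⟨_, hA.eigenvalues_mem_spectrum_real ⟨0, hk⟩⟩
  have hfin : (spectrum ℝ A).Finite := Matrix.finite_real_spectrum
  exact ⟨hne.csInf_mem hfin, fun a ha => csInf_le hfin.bddBelow ha⟩

/-!
The smallest eigenvalue is a concave function of the symmetric matrix, being the largest `c` with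
`c |v|² ≤ vᵀ Θ v` for all `v` (`le_lambdaMin_iff`, `concaveOn_lambdaMinΘ`). A scale mixture of
centred Gaussians is invariant under changing the signs of any chosen set of coordinates
(`IsGaussianScaleMixture.measurePreserving_flipSigns`). For patterns `z ≤ z'`, flip the signs of
the entries that are inactive under `z`: the matrix `Θ_z` is then the midpoint of `Θ_z'` and its
flipped copy, which have the same law, so that `E λ_min(Θ_z) ≥ E λ_min(Θ_z')` by concavity.

Since the expectations may be infinite, the comparison is carried out on the positive part `P` and
the negative part `N` separately: `N_z ≤ N_z'` and `N_z + P_z' ≤ P_z + N_z'` in `[0, ∞]`. These two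
inequalities imply the one between the expectations `P - N`
(`EReal.coe_ennreal_sub_le_coe_ennreal_sub`), and they can be averaged over random patterns. For
`η ≤ η'` the random patterns are coupled monotonically by thresholding the same uniform variables
at `η` and at `η'` (`thresholdPattern`).

Existence and finiteness follow from `λ_min(Θ) ≤ θ_ii` and from a lower bound of `λ_min(Θ)` by the
negative parts of the diagonal entries and the absolute values of the off-diagonal ones
(`lambdaMinΘ_le_diag`, `neg_le_lambdaMinΘ`).
-/

/-! ### The smallest eigenvalue as a concave function -/

open Matrix in
/-- Variational characterization: `λ_min(A)` is the largest `c` for which `A - c` is positive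
semidefinite. -/
theorem le_lambdaMin_iff {k : ℕ} (hk : 1 ≤ k) {A : Matrix (Fin k) (Fin k) ℝ}
    (hA : A.IsHermitian) (c : ℝ) :
    c ≤ lambdaMin A ↔ ∀ v : Fin k → ℝ, c * (v ⬝ᵥ v) ≤ v ⬝ᵥ (A *ᵥ v) := by
  constructor
  · intro hc v
    -- The spectrum of `A - c` is that of `A` shifted by `-c`, hence nonnegative.
    have hpos : (A - algebraMap ℝ _ c).PosSemidef := by
      refine posSemidef_iff_isHermitian_and_spectrum_nonneg.2 ⟨?_, fun a ha => ?_⟩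
      · refine hA.sub ?_
        rw [Algebra.algebraMap_eq_smul_one]
        simp [IsHermitian]
      · rw [← spectrum.sub_singleton_eq] at ha
        obtain ⟨b, hb, _, rfl, rfl⟩ := ha
        exact sub_nonneg.2 (hc.trans ((isLeast_lambdaMin hk hA).2 hb))
    have h := hpos.dotProduct_mulVec_nonneg v
    rw [Algebra.algebraMap_eq_smul_one, sub_mulVec, dotProduct_sub, smul_mulVec, one_mulVec,
      dotProduct_smul, star_trivial, smul_eq_mul] at h
    linarith
  · intro h
    have hmem := (isLeast_lambdaMin hk hA).1
    -- Test the inequality on an eigenvector for the smallest eigenvalue.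
    rw [hA.spectrum_real_eq_range_eigenvalues] at hmem
    obtain ⟨i, hi⟩ := hmem
    set v : Fin k → ℝ := ⇑(hA.eigenvectorBasis i) with hv
    have hv0 : v ≠ 0 := by
      intro h0
      apply hA.eigenvectorBasis.toBasis.ne_zero i
      ext j
      simpa [hv] using congrFun h0 j
    have hpos : 0 < v ⬝ᵥ v := by
      simpa using dotProduct_star_self_pos_iff.2 hv0
    have := h v
    rw [hv, hA.mulVec_eigenvectorBasis, ← hv, dotProduct_smul, smul_eq_mul, hi] at this
    exact le_of_mul_le_mul_right this hpos

theorem symMatrix_smul_add_smul {k : ℕ} (a b : ℝ) (x y : Entries k) :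
    symMatrix (a • x + b • y) = a • symMatrix x + b • symMatrix y := by
  ext i j
  simp only [symMatrix, Matrix.of_apply, Matrix.add_apply, Matrix.smul_apply]
  split_ifs <;> simp

theorem concaveOn_lambdaMinΘ {k : ℕ} (hk : 1 ≤ k) :
    ConcaveOn ℝ Set.univ (lambdaMinΘ : Entries k → ℝ) := by
  refine ⟨convex_univ, fun x _ y _ a b ha hb _ => ?_⟩
  refine (le_lambdaMin_iff hk (isHermitian_symMatrix _) _).2 fun v => ?_
  have hx := (le_lambdaMin_iff hk (isHermitian_symMatrix x) _).1 le_rfl v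
  have hy := (le_lambdaMin_iff hk (isHermitian_symMatrix y) _).1 le_rfl v
  rw [symMatrix_smul_add_smul, Matrix.add_mulVec, dotProduct_add, Matrix.smul_mulVec,
    Matrix.smul_mulVec, dotProduct_smul, dotProduct_smul]
  simp only [smul_eq_mul, lambdaMinΘ]
  linarith [mul_le_mul_of_nonneg_left hx ha, mul_le_mul_of_nonneg_left hy hb]

/-- A finite concave function on a finite-dimensional space is continuous, hence measurable. -/
theorem measurable_lambdaMinΘ {k : ℕ} (hk : 1 ≤ k) :
    Measurable (lambdaMinΘ : Entries k → ℝ) :=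
  (continuousOn_univ.1 ((concaveOn_lambdaMinΘ hk).continuousOn isOpen_univ)).measurable

theorem lambdaMinΘ_le_diag {k : ℕ} (hk : 1 ≤ k) (x : Entries k) (i : Fin k) :
    lambdaMinΘ x ≤ x.1 i := by
  have h := (le_lambdaMin_iff hk (isHermitian_symMatrix x) _).1 le_rfl (Pi.single i 1)
  simpa [symMatrix, lambdaMinΘ] using h

theorem abs_mul_le_dotProduct_self {ι : Type*} [Fintype ι] (v : ι → ℝ) (i j : ι) :
    |v i * v j| ≤ v ⬝ᵥ v := by
  have hsq : ∀ l, v l * v l ≤ v ⬝ᵥ v := fun l =>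
    Finset.single_le_sum (f := fun l => v l * v l) (fun l _ => mul_self_nonneg _)
      (Finset.mem_univ l)
  rw [abs_mul]
  nlinarith [sq_nonneg (|v i| - |v j|), hsq i, hsq j, abs_mul_abs_self (v i),
    abs_mul_abs_self (v j)]

/-- Crude, but integrable: only the negative parts of the diagonal entries occur, so the bound does
not involve the diagonal at all when the diagonal is nonnegative. -/
theorem neg_le_lambdaMinΘ {k : ℕ} (hk : 1 ≤ k) (x : Entries k) :
    -(∑ i, max (-x.1 i) 0 + (k : ℝ) ^ 2 * ∑ e, |x.2 e|) ≤ lambdaMinΘ x := by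
  refine (le_lambdaMin_iff hk (isHermitian_symMatrix x) _).2 fun v => ?_
  set C := ∑ e, |x.2 e| with hC
  have hCe : ∀ e, |x.2 e| ≤ C := fun e =>
    Finset.single_le_sum (f := fun e => |x.2 e|) (fun e _ => abs_nonneg _) (Finset.mem_univ e)
  have hC0 : 0 ≤ C := Finset.sum_nonneg fun e _ => abs_nonneg _
  have hs0 : 0 ≤ v ⬝ᵥ v := by simpa using dotProduct_star_self_nonneg v
  -- Each term of the quadratic form is bounded separately, using `|v i * v j| ≤ v ⬝ᵥ v`.
  have key : ∀ i j, -(((if i = j then max (-x.1 i) 0 else 0) + C) * (v ⬝ᵥ v)) ≤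
      v i * (symMatrix x i j * v j) := by
    intro i j
    by_cases hij : i = j
    · subst hij
      have hii : symMatrix x i i = x.1 i := by simp [symMatrix]
      have h1 := abs_mul_le_dotProduct_self v i i
      rw [abs_of_nonneg (mul_self_nonneg _)] at h1
      have h2 := mul_le_mul_of_nonneg_left h1 (le_max_right (-x.1 i) 0)
      have h3 := mul_le_mul_of_nonneg_right (le_max_left (-x.1 i) 0) (mul_self_nonneg (v i))
      rw [hii, if_pos rfl]
      nlinarith [mul_nonneg hC0 hs0]
    · have hle : |symMatrix x i j| ≤ C := by
        rcases lt_or_gt_of_ne hij with h | h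
        · simpa [symMatrix, h] using hCe ⟨(i, j), h⟩
        · simpa [symMatrix, h, h.asymm] using hCe ⟨(j, i), h⟩
      rw [if_neg hij, zero_add]
      have h1 : |v i * (symMatrix x i j * v j)| ≤ C * (v ⬝ᵥ v) := by
        rw [mul_left_comm, abs_mul]
        exact mul_le_mul hle (abs_mul_le_dotProduct_self v i j) (abs_nonneg _) hC0
      exact (abs_le.1 h1).1
  have hsum := Finset.sum_le_sum fun i (_ : i ∈ Finset.univ) =>
    Finset.sum_le_sum fun j (_ : j ∈ Finset.univ) => key i j
  calc _ = ∑ i, ∑ j, -(((if i = j then max (-x.1 i) 0 else 0) + C) * (v ⬝ᵥ v)) := by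
        simp only [Finset.sum_neg_distrib, ← Finset.sum_mul, Finset.sum_add_distrib,
          Finset.sum_ite_eq, Finset.mem_univ, if_true, Finset.sum_const, Finset.card_univ,
          Fintype.card_fin, nsmul_eq_mul]
        ring
    _ ≤ _ := hsum
    _ = _ := by simp only [dotProduct, Matrix.mulVec, Finset.mul_sum]

/-! ### Sign symmetry of Gaussian scale mixtures -/

instance {k : ℕ} (v : OffDiag k → ℝ≥0) : IsProbabilityMeasure (gaussianSlab v) := by
  unfold gaussianSlab
  infer_instance

theorem IsGaussianScaleMixture.isProbabilityMeasure {k : ℕ} {ν : Measure (OffDiag k → ℝ)}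
    (h : IsGaussianScaleMixture ν) : IsProbabilityMeasure ν := by
  obtain ⟨M, hM, rfl⟩ := h
  refine ⟨?_⟩
  rw [Measure.bind_apply MeasurableSet.univ measurable_gaussianSlab.aemeasurable]
  simp

/-- Change the signs of the entries `t e` with `s e = true`. -/
def flipSigns {k : ℕ} (s : Pattern k) (t : OffDiag k → ℝ) : OffDiag k → ℝ :=
  fun e => if s e then -t e else t e

theorem measurable_flipSigns {k : ℕ} (s : Pattern k) : Measurable (flipSigns s) := by
  refine measurable_pi_lambda _ fun e => ?_
  unfold flipSigns
  split_ifs <;> fun_prop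

theorem gaussianSlab_map_flipSigns {k : ℕ} (v : OffDiag k → ℝ≥0) (s : Pattern k) :
    (gaussianSlab v).map (flipSigns s) = gaussianSlab v := by
  have hcoord : ∀ e, (gaussianReal 0 (v e)).map (fun x : ℝ => if s e then -x else x) =
      gaussianReal 0 (v e) := by
    intro e
    split_ifs
    · simpa using gaussianReal_map_neg (μ := 0) (v := v e)
    · exact Measure.map_id
  have hmeas : ∀ e, Measurable fun x : ℝ => if s e then -x else x := fun e => by
    split_ifs <;> fun_prop
  have : ∀ e, SigmaFinite ((gaussianReal 0 (v e)).map (fun x : ℝ => if s e then -x else x)) :=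
    fun e => by rw [hcoord]; infer_instance
  calc _ = Measure.pi fun e => (gaussianReal 0 (v e)).map (fun x : ℝ => if s e then -x else x) :=
        Measure.pi_map_pi fun e => (hmeas e).aemeasurable
    _ = _ := by simp only [hcoord, gaussianSlab]

theorem IsGaussianScaleMixture.measurePreserving_flipSigns {k : ℕ}
    {ν : Measure (OffDiag k → ℝ)} (h : IsGaussianScaleMixture ν) (s : Pattern k) :
    MeasurePreserving (flipSigns s) ν ν := by
  refine ⟨measurable_flipSigns s, ?_⟩
  obtain ⟨M, hM, rfl⟩ := h
  ext A hA
  rw [Measure.map_apply (measurable_flipSigns s) hA,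
    Measure.bind_apply (measurable_flipSigns s hA) measurable_gaussianSlab.aemeasurable,
    Measure.bind_apply hA measurable_gaussianSlab.aemeasurable]
  refine lintegral_congr fun v => ?_
  rw [← Measure.map_apply (measurable_flipSigns s) hA, gaussianSlab_map_flipSigns]

theorem IsGaussianProduct.integrable_eval {k : ℕ} {ν : Measure (OffDiag k → ℝ)}
    (h : IsGaussianProduct ν) (e : OffDiag k) : Integrable (fun t => t e) ν := by
  obtain ⟨v, rfl⟩ := h
  have h1 : Integrable (fun x : ℝ => x) (gaussianReal 0 (v e)) :=
    (memLp_id_gaussianReal 1).integrable (by simp)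
  exact (measurePreserving_eval (fun e => gaussianReal 0 (v e)) e).integrable_comp_of_integrable h1

/-! ### Integrals under the priors -/

theorem measurable_mask {k : ℕ} (z : Pattern k) : Measurable (mask z) := by
  refine measurable_pi_lambda _ fun e => ?_
  unfold mask
  split_ifs <;> fun_prop

theorem lintegral_priorGiven {k : ℕ} {D : Fin k → Measure ℝ} [∀ i, IsProbabilityMeasure (D i)]
    {ν : Measure (OffDiag k → ℝ)} [IsProbabilityMeasure ν] (z : Pattern k)
    {f : Entries k → ℝ≥0∞} (hf : Measurable f) :
    ∫⁻ x, f x ∂(priorGiven D ν z) = ∫⁻ x, f (x.1, mask z x.2) ∂((Measure.pi D).prod ν) := by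
  have hmap : priorGiven D ν z = ((Measure.pi D).prod ν).map (Prod.map id (mask z)) := by
    rw [← Measure.map_prod_map _ _ measurable_id (measurable_mask z), Measure.map_id, priorGiven]
  rw [hmap, lintegral_map hf (measurable_id.prodMap (measurable_mask z))]
  rfl

theorem lintegral_prior {k : ℕ} {D : Fin k → Measure ℝ}
    {ν : Measure (OffDiag k → ℝ)} (η : OffDiag k → unitInterval)
    {f : Entries k → ℝ≥0∞} (hf : Measurable f) :
    ∫⁻ x, f x ∂(prior D ν η) = ∫⁻ z, ∫⁻ x, f x ∂(priorGiven D ν z) ∂(patternLaw η) :=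
  Measure.lintegral_bind (measurable_priorGiven D ν).aemeasurable hf.aemeasurable

/-! ### Monotone coupling of random patterns -/

/-- The pattern whose active entries are those with `u e ≤ η e`. For `u` uniform it has the law
`patternLaw η`, and with the same `u` for all `η` it is monotone in `η`. -/
noncomputable def thresholdPattern {k : ℕ} (η u : OffDiag k → unitInterval) : Pattern k :=
  fun e => decide (u e ≤ η e)

theorem thresholdPattern_mono {k : ℕ} {η η' : OffDiag k → unitInterval} (h : η ≤ η')
    (u : OffDiag k → unitInterval) : thresholdPattern η u ≤ thresholdPattern η' u := by
  intro e
  simp only [thresholdPattern]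
  by_cases hu : u e ≤ η e
  · simp [hu, hu.trans (h e)]
  · simp [hu]

theorem measurable_decide_le (p : unitInterval) :
    Measurable fun u : unitInterval => decide (u ≤ p) :=
  measurable_to_bool (by
    have : (fun u : unitInterval => decide (u ≤ p)) ⁻¹' {true} = Set.Iic p := by
      ext u; simp
    exact this ▸ measurableSet_Iic)

theorem bernoulliMeasure_eq_map_volume (p : unitInterval) :
    bernoulliMeasure true false p =
      (volume : Measure unitInterval).map (fun u => decide (u ≤ p)) := by
  have hm := measurable_decide_le p
  refine Measure.ext_of_singleton fun b => ?_
  rw [Measure.map_apply hm (measurableSet_singleton b)]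
  cases b
  · have : (fun u : unitInterval => decide (u ≤ p)) ⁻¹' {false} = Set.Ioi p := by
      ext u; simp
    rw [this, unitInterval.volume_Ioi,
      bernoulliMeasure_apply_of_notMem_of_mem p (measurableSet_singleton _) (by simp) (by simp)]
    rw [ENNReal.ofReal, ENNReal.coe_inj]
    ext
    simp [sub_nonneg.2 p.2.2]
  · have : (fun u : unitInterval => decide (u ≤ p)) ⁻¹' {true} = Set.Iic p := by
      ext u; simp
    rw [this, unitInterval.volume_Iic,
      bernoulliMeasure_apply_of_mem_of_notMem p (measurableSet_singleton _) (by simp) (by simp)]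
    rw [ENNReal.ofReal, ENNReal.coe_inj]
    ext
    simp [p.2.1]

theorem measurePreserving_thresholdPattern {k : ℕ} (η : OffDiag k → unitInterval) :
    MeasurePreserving (thresholdPattern η)
      (Measure.pi fun _ : OffDiag k => (volume : Measure unitInterval)) (patternLaw η) := by
  have hm : ∀ e, Measurable fun u : unitInterval => decide (u ≤ η e) := fun e =>
    measurable_decide_le (η e)
  have := measurePreserving_pi (fun _ : OffDiag k => (volume : Measure unitInterval))
    (fun e => bernoulliMeasure true false (η e))
    (fun e => ⟨hm e, (bernoulliMeasure_eq_map_volume (η e)).symm⟩)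
  exact this

/-! ### Comparison of expectations in `[-∞, ∞]` -/

/-- The comparison of two expectations `P - N` in `[-∞, ∞]` from two inequalities in `[0, ∞]`. Only
the smaller expectation has to be well defined. -/
theorem EReal.coe_ennreal_sub_le_coe_ennreal_sub {P N P' N' : ℝ≥0∞} (hN : N ≤ N')
    (h : N + P' ≤ P + N') (hex : P' ≠ ∞ ∨ N' ≠ ∞) :
    (P' : EReal) - (N' : EReal) ≤ (P : EReal) - (N : EReal) := by
  by_cases hN' : N' = ∞
  · -- `P'` is finite, so that `P' - ∞ = ⊥` without the convention for `∞ - ∞`.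
    subst hN'
    lift P' to ℝ≥0 using hex.resolve_right (by simp)
    simp
  have hN0 : N ≠ ∞ := ne_top_of_le_ne_top hN' hN
  lift N to ℝ≥0 using hN0
  lift N' to ℝ≥0 using hN'
  by_cases hP : P = ∞
  · subst hP
    rw [EReal.coe_ennreal_top]
    simp
  lift P to ℝ≥0 using hP
  have hP' : P' ≠ ∞ := by
    rintro rfl
    simp [← ENNReal.coe_add] at h
  lift P' to ℝ≥0 using hP'
  have h' : (N : ℝ) + P' ≤ P + N' := by exact_mod_cast h
  change ((P' : ℝ) : EReal) - ((N' : ℝ) : EReal) ≤ ((P : ℝ) : EReal) - ((N : ℝ) : EReal)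
  rw [← EReal.coe_sub, ← EReal.coe_sub, EReal.coe_le_coe_iff]
  linarith

/-- If `h` dominates the average of `g` and of an equidistributed copy `g ∘ T`, then its negative
part has the smaller integral. -/
theorem lintegral_ofReal_neg_le_of_add_comp_le {Ω : Type*} [MeasurableSpace Ω] {μ : Measure Ω}
    {T : Ω → Ω} (hT : MeasurePreserving T μ μ) {g h : Ω → ℝ} (hg : Measurable g)
    (hgh : ∀ x, g x + g (T x) ≤ 2 * h x) :
    ∫⁻ x, ENNReal.ofReal (-h x) ∂μ ≤ ∫⁻ x, ENNReal.ofReal (-g x) ∂μ := by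
  have hpt : ∀ x, 2 * ENNReal.ofReal (-h x) ≤
      ENNReal.ofReal (-g x) + ENNReal.ofReal (-g (T x)) := by
    intro x
    have hx := hgh x
    simp only [ENNReal.ofReal]
    norm_cast
    rw [← NNReal.coe_le_coe]
    push_cast [Real.coe_toNNReal']
    grind
  have hint := lintegral_mono (μ := μ) hpt
  rw [lintegral_const_mul' _ _ (by simp), lintegral_add_left hg.fun_neg.ennreal_ofReal,
    hT.lintegral_comp (f := fun x => ENNReal.ofReal (-g x)) hg.fun_neg.ennreal_ofReal,
    ← two_mul] at hint
  exact (ENNReal.mul_le_mul_iff_right (by simp) (by simp)).1 hint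

/-- If `h` dominates the average of `g` and of an equidistributed copy `g ∘ T`, then `E h ≥ E g`.
This is written without subtraction, so that it makes sense for infinite integrals. -/
theorem lintegral_ofReal_add_le_of_add_comp_le {Ω : Type*} [MeasurableSpace Ω] {μ : Measure Ω}
    {T : Ω → Ω} (hT : MeasurePreserving T μ μ) {g h : Ω → ℝ} (hg : Measurable g)
    (hh : Measurable h) (hgh : ∀ x, g x + g (T x) ≤ 2 * h x) :
    ∫⁻ x, ENNReal.ofReal (-h x) ∂μ + ∫⁻ x, ENNReal.ofReal (g x) ∂μ ≤
      ∫⁻ x, ENNReal.ofReal (h x) ∂μ + ∫⁻ x, ENNReal.ofReal (-g x) ∂μ := by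
  have hpt : ∀ x, 2 * ENNReal.ofReal (-h x) +
        (ENNReal.ofReal (g x) + ENNReal.ofReal (g (T x))) ≤
      2 * ENNReal.ofReal (h x) + (ENNReal.ofReal (-g x) + ENNReal.ofReal (-g (T x))) := by
    intro x
    have hx := hgh x
    simp only [ENNReal.ofReal]
    norm_cast
    rw [← NNReal.coe_le_coe]
    push_cast [Real.coe_toNNReal']
    grind
  have hint := lintegral_mono (μ := μ) hpt
  rw [lintegral_add_left (hh.fun_neg.ennreal_ofReal.const_mul 2),
    lintegral_add_left (hh.ennreal_ofReal.const_mul 2),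
    lintegral_const_mul' _ _ (by simp), lintegral_const_mul' _ _ (by simp),
    lintegral_add_left hg.ennreal_ofReal, lintegral_add_left hg.fun_neg.ennreal_ofReal,
    hT.lintegral_comp (f := fun x => ENNReal.ofReal (g x)) hg.ennreal_ofReal,
    hT.lintegral_comp (f := fun x => ENNReal.ofReal (-g x)) hg.fun_neg.ennreal_ofReal,
    ← two_mul, ← two_mul, ← mul_add, ← mul_add] at hint
  exact (ENNReal.mul_le_mul_iff_right (by simp) (by simp)).1 hint

theorem integrable_of_lintegral_ofReal_ne_top {Ω : Type*} [MeasurableSpace Ω] {μ : Measure Ω}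
    {f : Ω → ℝ} (hf : Measurable f) (hpos : ∫⁻ x, ENNReal.ofReal (f x) ∂μ ≠ ∞)
    (hneg : ∫⁻ x, ENNReal.ofReal (-f x) ∂μ ≠ ∞) : Integrable f μ := by
  refine ⟨hf.aestronglyMeasurable, ?_⟩
  rw [hasFiniteIntegral_iff_enorm]
  have hle : ∀ x, ‖f x‖ₑ ≤ ENNReal.ofReal (f x) + ENNReal.ofReal (-f x) := by
    intro x
    rw [Real.enorm_eq_ofReal_abs]
    rcases le_total 0 (f x) with h | h
    · rw [abs_of_nonneg h]; exact le_self_add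
    · rw [abs_of_nonpos h]; exact le_add_self
  refine (lintegral_mono hle).trans_lt ?_
  rw [lintegral_add_left hf.ennreal_ofReal]
  exact ENNReal.add_lt_top.2 ⟨hpos.lt_top, hneg.lt_top⟩

/-! ### Monotonicity in the pattern and in the activation probabilities -/

/-- Concavity at the midpoint: averaging over the signs of the entries that are inactive under `z`
removes exactly these entries from the pattern `z'`. -/
theorem lambdaMinΘ_mask_add_le {k : ℕ} (hk : 1 ≤ k) {z z' : Pattern k} (hz : z ≤ z')
    (d : Fin k → ℝ) (t : OffDiag k → ℝ) :
    lambdaMinΘ (d, mask z' t) + lambdaMinΘ (d, mask z' (flipSigns (fun e => !z e) t)) ≤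
      2 * lambdaMinΘ (d, mask z t) := by
  have h := (concaveOn_lambdaMinΘ hk).2 (Set.mem_univ (d, mask z' t))
    (Set.mem_univ (d, mask z' (flipSigns (fun e => !z e) t)))
    (by norm_num : (0 : ℝ) ≤ 1 / 2) (by norm_num : (0 : ℝ) ≤ 1 / 2) (by norm_num)
  have hmid : (1 / 2 : ℝ) • ((d, mask z' t) : Entries k) +
      (1 / 2 : ℝ) • (d, mask z' (flipSigns (fun e => !z e) t)) = (d, mask z t) := by
    refine Prod.ext (funext fun i => ?_) (funext fun e => ?_)
    · simp only [Prod.fst_add, Prod.smul_fst, Pi.add_apply, Pi.smul_apply, smul_eq_mul]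
      ring
    · have he := hz e
      simp only [Prod.snd_add, Prod.smul_snd, Pi.add_apply, Pi.smul_apply, smul_eq_mul, mask,
        flipSigns]
      rcases Bool.eq_false_or_eq_true (z e) with hze | hze
      · have hze' : z' e = true := Bool.eq_true_of_true_le (hze ▸ he)
        simp only [hze, hze', Bool.not_true, if_true, Bool.false_eq_true, if_false]
        ring
      · simp only [hze, Bool.not_false, if_true, Bool.false_eq_true, if_false]
        split_ifs <;> ring
  rw [hmid] at h
  simp only [smul_eq_mul] at h
  linarith

theorem lintegral_prior_eq_thresholdPattern {k : ℕ} {D : Fin k → Measure ℝ}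
    {ν : Measure (OffDiag k → ℝ)} (η : OffDiag k → unitInterval)
    {f : Entries k → ℝ≥0∞} (hf : Measurable f) :
    ∫⁻ x, f x ∂(prior D ν η) =
      ∫⁻ u, ∫⁻ x, f x ∂(priorGiven D ν (thresholdPattern η u))
        ∂(Measure.pi fun _ : OffDiag k => (volume : Measure unitInterval)) := by
  rw [lintegral_prior η hf, ← (measurePreserving_thresholdPattern η).lintegral_comp
    (measurable_of_countable _)]

/-- There are finitely many patterns, so finiteness under every pattern passes to the mixture. -/
theorem lintegral_prior_ne_top {k : ℕ} {D : Fin k → Measure ℝ}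
    {ν : Measure (OffDiag k → ℝ)} (η : OffDiag k → unitInterval) {f : Entries k → ℝ≥0∞}
    (hf : Measurable f) (h : ∀ z, ∫⁻ x, f x ∂(priorGiven D ν z) ≠ ∞) :
    ∫⁻ x, f x ∂(prior D ν η) ≠ ∞ := by
  have : IsProbabilityMeasure (patternLaw η) := by
    unfold patternLaw
    infer_instance
  rw [lintegral_prior η hf, lintegral_fintype]
  exact ENNReal.sum_ne_top.2 fun z _ => ENNReal.mul_ne_top (h z) (measure_ne_top _ _)

section Moments

variable {k : ℕ} {D : Fin k → Measure ℝ} [∀ i, IsProbabilityMeasure (D i)]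
  {ν : Measure (OffDiag k → ℝ)}

theorem measurable_lambdaMinΘ_mask (hk : 1 ≤ k) (z : Pattern k) :
    Measurable fun x : Entries k => lambdaMinΘ (x.1, mask z x.2) :=
  (measurable_lambdaMinΘ hk).comp
    (measurable_fst.prodMk ((measurable_mask z).comp measurable_snd))

theorem lintegral_ofReal_neg_priorGiven_mono (hk : 1 ≤ k) (hν : IsGaussianScaleMixture ν)
    {z z' : Pattern k} (hz : z ≤ z') :
    ∫⁻ x, ENNReal.ofReal (-lambdaMinΘ x) ∂(priorGiven D ν z) ≤
      ∫⁻ x, ENNReal.ofReal (-lambdaMinΘ x) ∂(priorGiven D ν z') := by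
  have := hν.isProbabilityMeasure
  have hm := measurable_lambdaMinΘ hk
  rw [lintegral_priorGiven z hm.fun_neg.ennreal_ofReal,
    lintegral_priorGiven z' hm.fun_neg.ennreal_ofReal]
  exact lintegral_ofReal_neg_le_of_add_comp_le
    ((MeasurePreserving.id _).prod (hν.measurePreserving_flipSigns fun e => !z e))
    (measurable_lambdaMinΘ_mask hk z') fun x => lambdaMinΘ_mask_add_le hk hz x.1 x.2

theorem lintegral_ofReal_priorGiven_add_le (hk : 1 ≤ k) (hν : IsGaussianScaleMixture ν)
    {z z' : Pattern k} (hz : z ≤ z') :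
    ∫⁻ x, ENNReal.ofReal (-lambdaMinΘ x) ∂(priorGiven D ν z) +
        ∫⁻ x, ENNReal.ofReal (lambdaMinΘ x) ∂(priorGiven D ν z') ≤
      ∫⁻ x, ENNReal.ofReal (lambdaMinΘ x) ∂(priorGiven D ν z) +
        ∫⁻ x, ENNReal.ofReal (-lambdaMinΘ x) ∂(priorGiven D ν z') := by
  have := hν.isProbabilityMeasure
  have hm := measurable_lambdaMinΘ hk
  rw [lintegral_priorGiven z hm.fun_neg.ennreal_ofReal,
    lintegral_priorGiven z' hm.fun_neg.ennreal_ofReal,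
    lintegral_priorGiven z hm.ennreal_ofReal, lintegral_priorGiven z' hm.ennreal_ofReal]
  exact lintegral_ofReal_add_le_of_add_comp_le
    ((MeasurePreserving.id _).prod (hν.measurePreserving_flipSigns fun e => !z e))
    (measurable_lambdaMinΘ_mask hk z') (measurable_lambdaMinΘ_mask hk z)
    fun x => lambdaMinΘ_mask_add_le hk hz x.1 x.2

theorem expectation_priorGiven_anti (hk : 1 ≤ k) (hν : IsGaussianScaleMixture ν)
    {z z' : Pattern k} (hz : z ≤ z') (h : HasExpectation (priorGiven D ν z') lambdaMinΘ) :
    expectation (priorGiven D ν z') lambdaMinΘ ≤ expectation (priorGiven D ν z) lambdaMinΘ :=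
  EReal.coe_ennreal_sub_le_coe_ennreal_sub (lintegral_ofReal_neg_priorGiven_mono hk hν hz)
    (lintegral_ofReal_priorGiven_add_le hk hν hz) h

theorem expectation_prior_anti (hk : 1 ≤ k) (hν : IsGaussianScaleMixture ν)
    {η η' : OffDiag k → unitInterval} (hη : η ≤ η')
    (h : HasExpectation (prior D ν η') lambdaMinΘ) :
    expectation (prior D ν η') lambdaMinΘ ≤ expectation (prior D ν η) lambdaMinΘ := by
  have hm := measurable_lambdaMinΘ hk
  have hmeas : ∀ (η : OffDiag k → unitInterval) (f : Entries k → ℝ≥0∞),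
      Measurable fun u => ∫⁻ x, f x ∂(priorGiven D ν (thresholdPattern η u)) := fun η f =>
    (measurable_of_countable fun z => ∫⁻ x, f x ∂(priorGiven D ν z)).comp
      (measurePreserving_thresholdPattern η).measurable
  refine EReal.coe_ennreal_sub_le_coe_ennreal_sub ?_ ?_ h
  · rw [lintegral_prior_eq_thresholdPattern η hm.fun_neg.ennreal_ofReal,
      lintegral_prior_eq_thresholdPattern η' hm.fun_neg.ennreal_ofReal]
    exact lintegral_mono fun u =>
      lintegral_ofReal_neg_priorGiven_mono hk hν (thresholdPattern_mono hη u)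
  · rw [lintegral_prior_eq_thresholdPattern η hm.fun_neg.ennreal_ofReal,
      lintegral_prior_eq_thresholdPattern η' hm.fun_neg.ennreal_ofReal,
      lintegral_prior_eq_thresholdPattern η hm.ennreal_ofReal,
      lintegral_prior_eq_thresholdPattern η' hm.ennreal_ofReal,
      ← lintegral_add_left (hmeas _ _), ← lintegral_add_left (hmeas _ _)]
    exact lintegral_mono fun u =>
      lintegral_ofReal_priorGiven_add_le hk hν (thresholdPattern_mono hη u)

/-! ### Existence and finiteness of the expectations -/

variable [IsProbabilityMeasure ν]

theorem lintegral_ofReal_priorGiven_ne_top (hk : 1 ≤ k) {i : Fin k}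
    (hi : Integrable (fun x => x) (D i)) (z : Pattern k) :
    ∫⁻ x, ENNReal.ofReal (lambdaMinΘ x) ∂(priorGiven D ν z) ≠ ∞ := by
  rw [lintegral_priorGiven z (measurable_lambdaMinΘ hk).ennreal_ofReal]
  have hint : Integrable (fun x : Entries k => x.1 i) ((Measure.pi D).prod ν) :=
    ((measurePreserving_eval D i).comp measurePreserving_fst).integrable_comp_of_integrable hi
  refine ne_top_of_le_ne_top hint.2.ne (lintegral_mono fun x => ?_)
  exact (ENNReal.ofReal_le_ofReal (lambdaMinΘ_le_diag hk _ i)).trans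
    (Real.ofReal_le_enorm _)

theorem lintegral_ofReal_neg_priorGiven_ne_top (hk : 1 ≤ k)
    (hD : ∀ i, Integrable (fun x => max (-x) 0) (D i))
    (hν : ∀ e : OffDiag k, Integrable (fun t => t e) ν) (z : Pattern k) :
    ∫⁻ x, ENNReal.ofReal (-lambdaMinΘ x) ∂(priorGiven D ν z) ≠ ∞ := by
  rw [lintegral_priorGiven z (measurable_lambdaMinΘ hk).fun_neg.ennreal_ofReal]
  have hdiag : ∀ i, Integrable (fun x : Entries k => max (-x.1 i) 0) ((Measure.pi D).prod ν) :=
    fun i => ((measurePreserving_eval D i).comp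
      measurePreserving_fst).integrable_comp_of_integrable (hD i)
  have hoff : ∀ e, Integrable (fun x : Entries k => |x.2 e|) ((Measure.pi D).prod ν) :=
    fun e => (measurePreserving_snd.integrable_comp_of_integrable (hν e)).abs
  have hint : Integrable (fun x : Entries k =>
      ∑ i, max (-x.1 i) 0 + (k : ℝ) ^ 2 * ∑ e, |x.2 e|) ((Measure.pi D).prod ν) :=
    (integrable_finsetSum _ fun i _ => hdiag i).add
      ((integrable_finsetSum _ fun e _ => hoff e).const_mul _)
  refine ne_top_of_le_ne_top hint.2.ne (lintegral_mono fun x => ?_)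
  refine (ENNReal.ofReal_le_ofReal ?_).trans (Real.ofReal_le_enorm _)
  have hmask : ∑ e, |mask z x.2 e| ≤ ∑ e, |x.2 e| := by
    refine Finset.sum_le_sum fun e _ => ?_
    unfold mask
    split_ifs <;> simp
  have h1 := neg_le_lambdaMinΘ hk (x.1, mask z x.2)
  have h2 := mul_le_mul_of_nonneg_left hmask (sq_nonneg (k : ℝ))
  simp only at h1
  linarith

end Moments

theorem mainTheorem3 (k : ℕ) (hk : 1 ≤ k)
    (D : Fin k → Measure ℝ) (hD : ∀ i, IsProbabilityMeasure (D i))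
    (ν : Measure (OffDiag k → ℝ)) (hν : IsGaussianProduct ν ∨ IsGaussianScaleMixture ν) :
    -- fixed patterns
    (∀ z z' : Pattern k, z ≤ z' →
      HasExpectation (priorGiven D ν z) lambdaMinΘ →
      HasExpectation (priorGiven D ν z') lambdaMinΘ →
      expectation (priorGiven D ν z') lambdaMinΘ ≤ expectation (priorGiven D ν z) lambdaMinΘ) ∧
    -- random patterns
    (∀ η η' : OffDiag k → unitInterval, η ≤ η' →
      HasExpectation (prior D ν η) lambdaMinΘ →
      HasExpectation (prior D ν η') lambdaMinΘ →
      expectation (prior D ν η') lambdaMinΘ ≤ expectation (prior D ν η) lambdaMinΘ) ∧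
    -- the expectations exist for nonnegative diagonals and slabs that are Gaussian or integrable
    ((∀ i, ∀ᵐ x ∂(D i), 0 ≤ x) →
      (IsGaussianProduct ν ∨ ∀ e : OffDiag k, Integrable (fun t => t e) ν) →
      (∀ z, HasExpectation (priorGiven D ν z) lambdaMinΘ) ∧
        ∀ η, HasExpectation (prior D ν η) lambdaMinΘ) ∧
    -- the expectations exist for all slabs if some diagonal entry is integrable
    ((∃ i, Integrable (fun x => x) (D i)) →
      (∀ z, HasExpectation (priorGiven D ν z) lambdaMinΘ) ∧
        ∀ η, HasExpectation (prior D ν η) lambdaMinΘ) ∧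
    -- they are finite if the diagonal is integrable and the slabs are Gaussian or integrable
    ((∀ i, Integrable (fun x => x) (D i)) →
      (IsGaussianProduct ν ∨ ∀ e : OffDiag k, Integrable (fun t => t e) ν) →
      (∀ z, Integrable lambdaMinΘ (priorGiven D ν z)) ∧
        ∀ η, Integrable lambdaMinΘ (prior D ν η)) := by
  have hmix : IsGaussianScaleMixture ν := hν.elim IsGaussianProduct.isGaussianScaleMixture id
  have hprob := hmix.isProbabilityMeasure
  have hm := measurable_lambdaMinΘ hk
  have hslab : (IsGaussianProduct ν ∨ ∀ e : OffDiag k, Integrable (fun t => t e) ν) →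
      ∀ e : OffDiag k, Integrable (fun t => t e) ν :=
    fun h => h.elim IsGaussianProduct.integrable_eval id
  refine ⟨fun z z' hz _ h => expectation_priorGiven_anti hk hmix hz h,
    fun η η' hη _ h => expectation_prior_anti hk hmix hη h, fun hpos hs => ?_, ?_,
    fun hi hs => ?_⟩
  · have hneg : ∀ i, Integrable (fun x => max (-x) 0) (D i) := fun i =>
      (integrable_zero ℝ ℝ (D i)).congr ((hpos i).mono fun x hx => by simpa using hx)
    have hfin := lintegral_ofReal_neg_priorGiven_ne_top hk hneg (hslab hs)
    exact ⟨fun z => Or.inr (hfin z),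
      fun η => Or.inr (lintegral_prior_ne_top η hm.fun_neg.ennreal_ofReal hfin)⟩
  · rintro ⟨i, hi⟩
    have hfin := lintegral_ofReal_priorGiven_ne_top (ν := ν) hk hi
    exact ⟨fun z => Or.inl (hfin z),
      fun η => Or.inl (lintegral_prior_ne_top η hm.ennreal_ofReal hfin)⟩
  · have hP := lintegral_ofReal_priorGiven_ne_top (ν := ν) hk (hi ⟨0, hk⟩)
    have hN := lintegral_ofReal_neg_priorGiven_ne_top hk (fun i => (hi i).neg.pos_part) (hslab hs)
    exact ⟨fun z => integrable_of_lintegral_ofReal_ne_top hm (hP z) (hN z),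
      fun η => integrable_of_lintegral_ofReal_ne_top hm
        (lintegral_prior_ne_top η hm.ennreal_ofReal hP)
        (lintegral_prior_ne_top η hm.fun_neg.ennreal_ofReal hN)⟩
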